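/- Let $\Delta_n$ be the simplex with $n$ vertices and let $\Delta_n^{(d)}$ be its $d$-dimensional skeleton. In the Linial--Meshulam model $G(\Delta_n^{(2)},p)$ with parameter $p=p(n)$, $0<p<1$, the random 2-complex $Y$ ranges over all simplicial complexes with $\Delta_n^{(1)}\subset Y\subset\Delta_n^{(2)}$, and has probability $\mathbb P(Y)=p^{f(Y)}(1-p)^{\binom n3-f(Y)}$, where $f(Y)$ is the number of 2-simplexes of $Y$. An edge of a 2-complex is *free* if it lies in exactly one 2-simplex, and a 2-simplex is *free* if at least one of its edges is free. A *simplicial collapse* $Y\searrow Y'$ chooses a free edge of each free 2-simplex of $Y$ and removes from $Y$ the interiors of all free 2-simplexes and of the chosen edges. Put $Y^{(0)}=Y$ and $Y^{(i)}\searrow Y^{(i+1)}$; then $Y$ is *collapsible to a graph in at most $k$ steps* if $Y^{(k)}$ has no 2-simplexes (this does not depend on the choices of the edges). Write $a_n\ll b_n$, or $b_n\gg a_n$, if $a_n>0$ and $a_n/b_n\to0$ as $n\to\infty$; a property holds *asymptotically almost surely* (a.a.s.) if its probability tends to $1$ as $n\to\infty$. **Theorem.** Let $k\ge1$ be an integer.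 (a) If $p\ll n^{-1-\frac{2}{k+1}}$, then $Y\in G(\Delta_n^{(2)},p)$ is collapsible to a graph in at most $k$ steps, a.a.s. (b) If $p\gg n^{-1-\frac{1}{3\cdot 2^{k-1}-1}}$, then $Y\in G(\Delta_n^{(2)},p)$ is not collapsible to a graph in $k$ or fewer steps, a.a.s. -/

import Mathlib

open Filter Topology

namespace RandomTwoComplex

/-! ### Simplicial collapse -/

section Collapse

variable {V : Type*}

/-- The 2-simplexes of a simplicial complex. -/
def triangles (Y : PreAbstractSimplicialComplex V) : Set (Finset V) :=
  {s | s ∈ Y.faces ∧ s.card = 3}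

/-- An edge of `Y` is free if it is included in exactly one 2-simplex of `Y`. -/
def IsFreeEdge (Y : PreAbstractSimplicialComplex V) (e : Finset V) : Prop :=
  e ∈ Y.faces ∧ e.card = 2 ∧ ∃! s, s ∈ triangles Y ∧ e ⊆ s

/-- The free 2-simplexes of `Y`: those with at least one free edge. -/
def freeTriangles (Y : PreAbstractSimplicialComplex V) : Set (Finset V) :=
  {s | s ∈ triangles Y ∧ ∃ e, IsFreeEdge Y e ∧ e ⊆ s}

/-- `Y'` is obtained from `Y` by collapsing all free 2-simplexes: a free edge `e s ⊆ s` is chosen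
for every free 2-simplex `s`, and the (open) simplexes `s` and `e s` are removed for all of them.
The complex `Y'` may depend on the choice of the edges. -/
def IsCollapse (Y Y' : PreAbstractSimplicialComplex V) : Prop :=
  ∃ e : Finset V → Finset V,
    (∀ s ∈ freeTriangles Y, IsFreeEdge Y (e s) ∧ e s ⊆ s) ∧
      Y'.faces = Y.faces \ (freeTriangles Y ∪ e '' freeTriangles Y)

/-- `Z` is the result `Y^(k)` of `k` successive simplicial collapses starting from `Y`. -/
def CollapsesIn : ℕ → PreAbstractSimplicialComplex V → PreAbstractSimplicialComplex V → Prop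
  | 0, Y, Z => Z = Y
  | k + 1, Y, Z => ∃ Y', IsCollapse Y Y' ∧ CollapsesIn k Y' Z

/-- A complex is a graph if it has no simplexes of dimension at least 2. -/
def IsGraph (Y : PreAbstractSimplicialComplex V) : Prop :=
  ∀ s ∈ Y.faces, s.card ≤ 2

/-- A complex has dimension at most 2. -/
def DimLETwo (Y : PreAbstractSimplicialComplex V) : Prop :=
  ∀ s ∈ Y.faces, s.card ≤ 3

/-- `Y` is collapsible to a graph in at most `k` steps: `Y^(k)` is a graph. For complexes of
dimension at most 2 this does not depend on the choices made in the collapses, see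
`collapsible_iff_forall`. -/
def CollapsibleInAtMost (k : ℕ) (Y : PreAbstractSimplicialComplex V) : Prop :=
  ∃ Z, CollapsesIn k Y Z ∧ IsGraph Z

/-- The 2-simplexes that survive a collapse are exactly those that are not free. -/
theorem IsCollapse.triangles_eq {Y Y' : PreAbstractSimplicialComplex V} (h : IsCollapse Y Y') :
    triangles Y' = triangles Y \ freeTriangles Y := by
  obtain ⟨e, he, hf⟩ := h
  ext s
  simp only [triangles, hf, Set.mem_ofPred_eq, Set.mem_sdiff, Set.mem_union, Set.mem_image]
  constructor
  · rintro ⟨⟨h1, h2⟩, h3⟩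
    exact ⟨⟨h1, h3⟩, fun h => h2 (Or.inl h)⟩
  · rintro ⟨⟨h1, h3⟩, h2⟩
    refine ⟨⟨h1, ?_⟩, h3⟩
    rintro (h | ⟨t, ht, rfl⟩)
    · exact h2 h
    · have := (he t ht).1.2.1
      omega

theorem IsCollapse.dimLETwo {Y Y' : PreAbstractSimplicialComplex V} (h : IsCollapse Y Y')
    (hY : DimLETwo Y) : DimLETwo Y' := by
  obtain ⟨e, _, hf⟩ := h
  intro s hs
  rw [hf] at hs
  exact hY s hs.1

theorem isFreeEdge_iff_triangles {Y : PreAbstractSimplicialComplex V} {e : Finset V} :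
    IsFreeEdge Y e ↔ e.card = 2 ∧ ∃! s, s ∈ triangles Y ∧ e ⊆ s := by
  refine ⟨fun h => h.2, fun h => ⟨?_, h⟩⟩
  obtain ⟨s, hs, -⟩ := h.2
  exact (Y.isRelLowerSet_faces hs.1.1).2 hs.2 (Finset.card_pos.1 (by omega))

theorem freeTriangles_congr {Y Z : PreAbstractSimplicialComplex V}
    (h : triangles Y = triangles Z) : freeTriangles Y = freeTriangles Z := by
  simp only [freeTriangles, isFreeEdge_iff_triangles, h]

/-- Every complex of dimension at most 2 admits a collapse. -/
theorem exists_isCollapse {Y : PreAbstractSimplicialComplex V} (hY : DimLETwo Y) :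
    ∃ Y', IsCollapse Y Y' := by
  classical
  have hch : ∀ s, ∃ e, s ∈ freeTriangles Y → IsFreeEdge Y e ∧ e ⊆ s := by
    intro s
    by_cases hs : s ∈ freeTriangles Y
    · obtain ⟨e, he⟩ := hs.2
      exact ⟨e, fun _ => he⟩
    · exact ⟨∅, fun h => absurd h hs⟩
  choose e he using hch
  refine ⟨⟨Y.faces \ (freeTriangles Y ∪ e '' freeTriangles Y), ?_⟩, e, he, rfl⟩
  rintro s ⟨hs, hsn⟩
  refine ⟨(Y.isRelLowerSet_faces hs).1, fun t hts htne => ?_⟩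
  refine ⟨(Y.isRelLowerSet_faces hs).2 hts htne, ?_⟩
  have hs3 := hY s hs
  rintro (ht | ⟨u, hu, rfl⟩)
  · have : t = s := Finset.eq_of_subset_of_card_le hts (by rw [ht.1.2]; exact hs3)
    exact hsn (Or.inl (this ▸ ht))
  · have hfe := (he u hu).1
    have hc := hfe.2.1
    have hle : (e u).card ≤ s.card := Finset.card_le_card hts
    rcases Nat.lt_or_ge (e u).card s.card with hlt | hge
    · have hst : s ∈ triangles Y := ⟨hs, by omega⟩
      exact hsn (Or.inl ⟨hst, e u, hfe, hts⟩)
    · have : e u = s := Finset.eq_of_subset_of_card_le hts hge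
      exact hsn (Or.inr ⟨u, hu, this⟩)

theorem exists_collapsesIn (k : ℕ) {Y : PreAbstractSimplicialComplex V} (hY : DimLETwo Y) :
    ∃ Z, CollapsesIn k Y Z := by
  induction k generalizing Y with
  | zero => exact ⟨Y, rfl⟩
  | succ k ih =>
    obtain ⟨Y', h⟩ := exists_isCollapse hY
    obtain ⟨Z, hZ⟩ := ih (h.dimLETwo hY)
    exact ⟨Z, Y', h, hZ⟩

theorem CollapsesIn.dimLETwo {k : ℕ} {Y Z : PreAbstractSimplicialComplex V}
    (h : CollapsesIn k Y Z) (hY : DimLETwo Y) : DimLETwo Z := by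
  induction k generalizing Y with
  | zero => obtain rfl : Z = Y := h; exact hY
  | succ k ih =>
    obtain ⟨Y', h1, h2⟩ := h
    exact ih h2 (h1.dimLETwo hY)

theorem CollapsesIn.triangles_congr {k : ℕ} {Y₁ Y₂ Z₁ Z₂ : PreAbstractSimplicialComplex V}
    (h₁ : CollapsesIn k Y₁ Z₁) (h₂ : CollapsesIn k Y₂ Z₂) (h : triangles Y₁ = triangles Y₂) :
    triangles Z₁ = triangles Z₂ := by
  induction k generalizing Y₁ Y₂ with
  | zero =>
    obtain rfl : Z₁ = Y₁ := h₁
    obtain rfl : Z₂ = Y₂ := h₂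
    exact h
  | succ k ih =>
    obtain ⟨W₁, hW₁, h₁⟩ := h₁
    obtain ⟨W₂, hW₂, h₂⟩ := h₂
    exact ih h₁ h₂ (by rw [hW₁.triangles_eq, hW₂.triangles_eq, freeTriangles_congr h, h])

theorem isGraph_iff_triangles {Y : PreAbstractSimplicialComplex V} (hY : DimLETwo Y) :
    IsGraph Y ↔ triangles Y = ∅ := by
  constructor
  · intro h
    ext s
    simp only [triangles, Set.mem_ofPred_eq, Set.mem_empty_iff_false, iff_false, not_and]
    intro hs hc
    have := h s hs
    omega
  · intro h s hs
    have h3 := hY s hs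
    by_contra hc
    have : s ∈ triangles Y := ⟨hs, by omega⟩
    rw [h] at this
    exact this

/-- Collapsibility in at most `k` steps does not depend on the choice of the collapses. -/
theorem collapsible_iff_forall {k : ℕ} {Y : PreAbstractSimplicialComplex V} (hY : DimLETwo Y) :
    CollapsibleInAtMost k Y ↔ ∀ Z, CollapsesIn k Y Z → IsGraph Z := by
  constructor
  · rintro ⟨W, hW, hg⟩ Z hZ
    rw [isGraph_iff_triangles (hW.dimLETwo hY)] at hg
    rw [isGraph_iff_triangles (hZ.dimLETwo hY), ← hg]
    exact hZ.triangles_congr hW rfl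
  · intro h
    obtain ⟨Z, hZ⟩ := exists_collapsesIn k hY
    exact ⟨Z, hZ, h Z hZ⟩

end Collapse

/-! ### The Linial–Meshulam model -/

/-- The `d`-dimensional skeleton of the simplex with vertex set `Fin n`. -/
def skeleton (n d : ℕ) : PreAbstractSimplicialComplex (Fin n) where
  faces := {s | s.Nonempty ∧ s.card ≤ d + 1}
  isRelLowerSet_faces := fun _ hs =>
    ⟨hs.1, fun _ ht hne => ⟨hne, (Finset.card_le_card ht).trans hs.2⟩⟩

/-- The sample space: all complexes between the 1-skeleton and the 2-skeleton of the simplex on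
`n` vertices. -/
def LMComplex (n : ℕ) : Type :=
  {Y : PreAbstractSimplicialComplex (Fin n) // skeleton n 1 ≤ Y ∧ Y ≤ skeleton n 2}

instance (n : ℕ) : Finite (LMComplex n) :=
  Finite.of_injective (fun Y : LMComplex n => Y.1.faces)
    (fun _ _ h => Subtype.ext (PreAbstractSimplicialComplex.ext h))

noncomputable instance (n : ℕ) : Fintype (LMComplex n) := Fintype.ofFinite _

/-- The number `f(Y)` of 2-simplexes of `Y`. -/
noncomputable def faceCount {n : ℕ} (Y : LMComplex n) : ℕ := (triangles Y.1).ncard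

/-- The probability of the outcome `Y`. -/
noncomputable def outcomeProb {n : ℕ} (p : ℝ) (Y : LMComplex n) : ℝ :=
  p ^ faceCount Y * (1 - p) ^ (n.choose 3 - faceCount Y)

/-- The probability of the event `A`. -/
noncomputable def eventProb {n : ℕ} (p : ℝ) (A : Set (LMComplex n)) : ℝ :=
  ∑ Y : LMComplex n, A.indicator (outcomeProb p) Y

/-- The random 2-complex on `n` vertices with parameter `p n` has the property `P` asymptotically
almost surely. -/
def AsymptoticallyAlmostSurely (p : ℕ → ℝ)
    (P : ∀ n : ℕ, PreAbstractSimplicialComplex (Fin n) → Prop) : Prop :=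
  Tendsto (fun n : ℕ => eventProb (p n) {Y : LMComplex n | P n Y.1}) atTop (𝓝 1)

/-- `a ≪ b`: the terms `a n` are positive (for large `n`) and `a n / b n → 0` as `n → ∞`. -/
def MuchLess (a b : ℕ → ℝ) : Prop :=
  (∀ᶠ n in atTop, 0 < a n) ∧ Tendsto (fun n => a n / b n) atTop (𝓝 0)

end RandomTwoComplex

/-! A triangle survives a collapse exactly when each of its edges lies in another triangle, so k
collapses amount to iterating the operator `core` k times on the set of triangles.

For (a), start from a triangle in `core^[k]` and repeatedly glue on a triangle along an edge that is
free in the current set F; each step costs one core level and adds at most one vertex. Either this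
runs k times, giving k+1 triangles on at most k+3 vertices, or it stops at a set of f ≤ k triangles
without free edges. In the latter every vertex lies in at least three triangles, so there are at
most f vertices (`exists_closed_or_grow`). The expected numbers of such sets are O(n^(k+3) p^(k+1))
and O((np)^f), and both tend to 0.

For (b), the ball of radius k in the triangulated tree, with 3·2^k vertices and 3·2^k - 2 triangles,
keeps its centre through k collapses. Any nonempty set of j of its triangles spans at least j+2
vertices, so the variance of the number of copies is governed by the terms 1/(n^(j+2) p^j). These
vanish above the threshold for the whole tree, and Chebyshev's inequality gives a copy a.a.s. -/

namespace RandomTwoComplex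

/-! ### Collapse as iteration of `core`, and dense sets forced by survival -/

section Core

variable {V : Type*}

/-- The members `s` of a family of sets such that every pair of elements of `s` is contained in
another member of the family. -/
def core (S : Set (Finset V)) : Set (Finset V) :=
  {s | s ∈ S ∧ ∀ e ⊆ s, e.card = 2 → ∃ t ∈ S, t ≠ s ∧ e ⊆ t}

theorem core_subset (S : Set (Finset V)) : core S ⊆ S := fun _ h => h.1

/-- The choice of removed edges is invisible on triangles: a pair inside a triangle is automatically
a face, so freeness depends on the triangles alone. -/
theorem IsCollapse.triangles_eq_core {Y Y' : PreAbstractSimplicialComplex V}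
    (h : IsCollapse Y Y') : triangles Y' = core (triangles Y) := by
  rw [h.triangles_eq]
  ext s
  constructor
  · rintro ⟨hs, hf⟩
    refine ⟨hs, fun e hes hc => ?_⟩
    by_contra! hne
    refine hf ⟨hs, e, isFreeEdge_iff_triangles.2 ⟨hc, s, ⟨hs, hes⟩, ?_⟩, hes⟩
    rintro t ⟨ht, het⟩
    by_contra hts
    exact hne t ht hts het
  · rintro ⟨hs, he⟩
    refine ⟨hs, ?_⟩
    rintro ⟨-, e, hfe, hes⟩
    obtain ⟨hc, u, -, hu⟩ := isFreeEdge_iff_triangles.1 hfe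
    obtain ⟨t, ht, hts, het⟩ := he e hes hc
    exact hts ((hu t ⟨ht, het⟩).trans (hu s ⟨hs, hes⟩).symm)

theorem CollapsesIn.triangles_eq_core {k : ℕ} {Y Z : PreAbstractSimplicialComplex V}
    (h : CollapsesIn k Y Z) : triangles Z = core^[k] (triangles Y) := by
  induction k generalizing Y with
  | zero => obtain rfl : Z = Y := h; rfl
  | succ k ih =>
    obtain ⟨Y', h1, h2⟩ := h
    rw [Function.iterate_succ_apply, ← h1.triangles_eq_core, ih h2]

theorem collapsibleInAtMost_iff_core {k : ℕ} {Y : PreAbstractSimplicialComplex V}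
    (hY : DimLETwo Y) : CollapsibleInAtMost k Y ↔ core^[k] (triangles Y) = ∅ := by
  constructor
  · rintro ⟨Z, hZ, hg⟩
    rw [← hZ.triangles_eq_core, (isGraph_iff_triangles (hZ.dimLETwo hY)).1 hg]
  · intro h
    obtain ⟨Z, hZ⟩ := exists_collapsesIn k hY
    refine ⟨Z, hZ, (isGraph_iff_triangles (hZ.dimLETwo hY)).2 ?_⟩
    rw [hZ.triangles_eq_core, h]

variable [DecidableEq V]

/-- For s = {x, a, b}, the second triangles on the edges xa and xb differ from s and from each
other, since a common one would contain x, a, b and so equal s. -/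
theorem three_le_card_filter_mem {F : Finset (Finset V)} (h3 : ∀ s ∈ F, s.card = 3)
    (hcl : ∀ s ∈ F, ∀ e ⊆ s, e.card = 2 → ∃ t ∈ F, t ≠ s ∧ e ⊆ t) {x : V}
    (hx : x ∈ F.biUnion id) : 3 ≤ (F.filter (x ∈ ·)).card := by
  obtain ⟨s, hs, hxs⟩ := Finset.mem_biUnion.1 hx
  simp only [id] at hxs
  have hc : (s.erase x).card = 2 := by rw [Finset.card_erase_of_mem hxs, h3 s hs]
  obtain ⟨a, b, hab, heq⟩ := Finset.card_eq_two.1 hc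
  have ha : a ∈ s.erase x := by simp [heq]
  have hb : b ∈ s.erase x := by simp [heq]
  rw [Finset.mem_erase] at ha hb
  obtain ⟨t, ht, hts, het⟩ := hcl s hs {x, a} (by
    intro y hy; rcases Finset.mem_insert.1 hy with rfl | hy
    · exact hxs
    · rw [Finset.mem_singleton.1 hy]; exact ha.2) (Finset.card_pair (Ne.symm ha.1))
  obtain ⟨u, hu, hus, heu⟩ := hcl s hs {x, b} (by
    intro y hy; rcases Finset.mem_insert.1 hy with rfl | hy
    · exact hxs
    · rw [Finset.mem_singleton.1 hy]; exact hb.2) (Finset.card_pair (Ne.symm hb.1))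
  have hs' : s = {x, a, b} := by rw [← heq, Finset.insert_erase hxs]
  have htu : t ≠ u := by
    rintro rfl
    refine hts (Finset.eq_of_subset_of_card_le (s := s) ?_ (by rw [h3 s hs, h3 t ht])).symm
    rw [hs']
    intro y hy
    simp only [Finset.mem_insert, Finset.mem_singleton] at hy
    rcases hy with rfl | rfl | rfl
    · exact het (by simp)
    · exact het (by simp)
    · exact heu (by simp)
  rw [← Finset.card_eq_three.2 ⟨s, t, u, hts.symm, hus.symm, htu, rfl⟩]
  refine Finset.card_le_card fun y hy => ?_
  simp only [Finset.mem_insert, Finset.mem_singleton] at hy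
  rw [Finset.mem_filter]
  rcases hy with rfl | rfl | rfl
  · exact ⟨hs, hxs⟩
  · exact ⟨ht, het (by simp)⟩
  · exact ⟨hu, heu (by simp)⟩

/-- A pure 2-complex without free edges has at most as many vertices as triangles. -/
theorem card_biUnion_le_card_of_closed {F : Finset (Finset V)} (h3 : ∀ s ∈ F, s.card = 3)
    (hcl : ∀ s ∈ F, ∀ e ⊆ s, e.card = 2 → ∃ t ∈ F, t ≠ s ∧ e ⊆ t) :
    (F.biUnion id).card ≤ F.card := by
  -- Double count incidences: each vertex lies in at least 3 triangles, each triangle has 3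
  -- vertices.
  have := Finset.card_mul_le_card_mul (s := F.biUnion id) (t := F) (fun x t => x ∈ t)
    (m := 3) (n := 3) (fun x hx => three_le_card_filter_mem h3 hcl hx)
    (fun t ht => by
      rw [← h3 t ht]
      exact Finset.card_le_card fun y hy => (Finset.mem_filter.1 hy).2)
  omega

/-- Growth by induction on j: members of `core^[i + 1] S` have all their edges covered a second time
inside `core^[i] S`, so a set at level k - j with a free edge can be enlarged at level k - j - 1. -/
theorem exists_closed_or_grow {S : Set (Finset V)} (h3 : ∀ s ∈ S, s.card = 3) {k : ℕ}
    {σ : Finset V} (hσ : σ ∈ core^[k] S) (j : ℕ) (hj : j ≤ k) :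
    (∃ F : Finset (Finset V), ↑F ⊆ S ∧ 1 ≤ F.card ∧ F.card ≤ k ∧
      (F.biUnion id).card ≤ F.card) ∨
    ∃ F : Finset (Finset V), ↑F ⊆ core^[k - j] S ∧ F.card = j + 1 ∧
      (F.biUnion id).card ≤ j + 3 := by
  have hsub : ∀ i, core^[i] S ⊆ S := fun i => by
    induction i with
    | zero => exact subset_rfl
    | succ i ih => rw [Function.iterate_succ_apply']; exact (core_subset _).trans ih
  induction j with
  | zero =>
    right
    refine ⟨{σ}, by simpa using hσ, by simp, ?_⟩
    simp [h3 σ (hsub _ hσ)]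
  | succ j ih =>
    obtain h | ⟨F, hF, hc, hv⟩ := ih (by omega)
    · exact Or.inl h
    have hk : k - j = (k - (j + 1)) + 1 := by omega
    rw [hk, Function.iterate_succ_apply'] at hF
    have hFS : ↑F ⊆ S := (hF.trans (core_subset _)).trans (hsub _)
    by_cases hcl : ∀ s ∈ F, ∀ e ⊆ s, e.card = 2 → ∃ t ∈ F, t ≠ s ∧ e ⊆ t
    · exact Or.inl ⟨F, hFS, by omega, by omega,
        card_biUnion_le_card_of_closed (fun s hs => h3 s (hFS hs)) hcl⟩
    · right
      push Not at hcl
      obtain ⟨s, hs, e, hes, he, hne⟩ := hcl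
      obtain ⟨t, ht, hts, het⟩ := (hF hs).2 e hes he
      have htF : t ∉ F := fun h => hne t h hts het
      refine ⟨insert t F, ?_, by rw [Finset.card_insert_of_notMem htF, hc], ?_⟩
      · rw [Finset.coe_insert]
        exact Set.insert_subset ht (hF.trans (core_subset _))
      -- The edge e already lies in F, so t contributes at most the single vertex of `t \ e`.
      · have h1 : (insert t F).biUnion id ⊆ (t \ e) ∪ F.biUnion id := by
          intro x hx
          rw [Finset.biUnion_insert, Finset.mem_union] at hx
          rw [Finset.mem_union]
          rcases hx with hx | hx
          · by_cases hxe : x ∈ e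
            · exact Or.inr (Finset.mem_biUnion.2 ⟨s, hs, hes hxe⟩)
            · exact Or.inl (Finset.mem_sdiff.2 ⟨hx, hxe⟩)
          · exact Or.inr hx
        have h2 := (Finset.card_le_card h1).trans (Finset.card_union_le _ _)
        have h4 := Finset.card_sdiff_add_card_eq_card het
        have h5 := h3 t (hsub _ ht)
        omega

/-- If some triangle survives `k` collapses, then there is a dense set of triangles. -/
theorem exists_dense_of_core_nonempty {S : Set (Finset V)} (h3 : ∀ s ∈ S, s.card = 3) {k : ℕ}
    (h : (core^[k] S).Nonempty) :
    (∃ f ∈ Finset.Icc 1 k, ∃ F : Finset (Finset V), ↑F ⊆ S ∧ F.card = f ∧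
      (F.biUnion id).card ≤ f) ∨
    ∃ F : Finset (Finset V), ↑F ⊆ S ∧ F.card = k + 1 ∧ (F.biUnion id).card ≤ k + 3 := by
  obtain ⟨σ, hσ⟩ := h
  obtain ⟨F, h1, h2, h4, h5⟩ | ⟨F, h1, h2, h4⟩ := exists_closed_or_grow h3 hσ k le_rfl
  · exact Or.inl ⟨F.card, Finset.mem_Icc.2 ⟨h2, h4⟩, F, h1, rfl, h5⟩
  · rw [Nat.sub_self] at h1
    exact Or.inr ⟨F, h1, h2, h4⟩

end Core

/-! ### Triangulated trees -/

/-- The edge to which the vertex `m` is attached in the infinite triangulated tree in which every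
edge lies in two triangles. -/
def treeEdge (m : ℕ) : ℕ × ℕ :=
  if h : m < 4 then (0, 1)
  else if m % 2 = 0 then ((treeEdge (m / 2)).1, m / 2) else ((treeEdge (m / 2)).2, m / 2)
decreasing_by all_goals omega

/-- The triangle with top vertex `m` of the triangulated tree. -/
def treeFace (m : ℕ) : Finset ℕ := {(treeEdge m).1, (treeEdge m).2, m}

theorem treeEdge_of_lt {m : ℕ} (h : m < 4) : treeEdge m = (0, 1) := by
  rw [treeEdge, dif_pos h]

theorem treeEdge_two_mul {m : ℕ} (h : 2 ≤ m) : treeEdge (2 * m) = ((treeEdge m).1, m) := by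
  rw [treeEdge, dif_neg (by omega), if_pos (by omega), Nat.mul_div_cancel_left _ two_pos]

theorem treeEdge_two_mul_add_one {m : ℕ} (h : 2 ≤ m) :
    treeEdge (2 * m + 1) = ((treeEdge m).2, m) := by
  rw [treeEdge, dif_neg (by omega), if_neg (by omega), show (2 * m + 1) / 2 = m by omega]

theorem treeEdge_lt {m : ℕ} (h : 2 ≤ m) :
    (treeEdge m).1 < (treeEdge m).2 ∧ (treeEdge m).2 < m := by
  induction m using Nat.strong_induction_on with
  | _ m ih =>
    by_cases h4 : m < 4
    · rw [treeEdge_of_lt h4]; exact ⟨zero_lt_one, by simp; omega⟩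
    · obtain ⟨i, rfl | rfl⟩ := Nat.even_or_odd' m
      · have := ih i (by omega) (by omega)
        rw [treeEdge_two_mul (by omega)]; simp only; omega
      · have := ih i (by omega) (by omega)
        rw [treeEdge_two_mul_add_one (by omega)]; simp only; omega

theorem le_of_mem_treeFace {m x : ℕ} (h : 2 ≤ m) (hx : x ∈ treeFace m) : x ≤ m := by
  have := treeEdge_lt h
  simp only [treeFace, Finset.mem_insert, Finset.mem_singleton] at hx
  omega

theorem mem_treeFace_self (m : ℕ) : m ∈ treeFace m := by simp [treeFace]

theorem card_treeFace {m : ℕ} (h : 2 ≤ m) : (treeFace m).card = 3 := by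
  have := treeEdge_lt h
  exact Finset.card_eq_three.2 ⟨_, _, _, by omega, by omega, by omega, rfl⟩

theorem treeFace_injOn : Set.InjOn treeFace {m | 2 ≤ m} := by
  intro a ha b hb hab
  refine le_antisymm ?_ ?_
  · exact le_of_mem_treeFace hb (hab ▸ mem_treeFace_self a)
  · exact le_of_mem_treeFace ha (hab ▸ mem_treeFace_self b)

/-- The labelling is binary: triangles 2m and 2m+1 sit on the two edges of triangle m at its top
vertex, while its base edge belongs to triangle m/2. Triangles 2 and 3 share the root edge and serve
as each other's neighbour. The bound 2m+1 makes one step outward at most double the range of labels.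
-/
theorem exists_ne_treeFace_superset {m : ℕ} (h : 2 ≤ m) {e : Finset ℕ} (he : e ⊆ treeFace m)
    (hc : e.card = 2) : ∃ i, 2 ≤ i ∧ i ≤ 2 * m + 1 ∧ i ≠ m ∧ e ⊆ treeFace i := by
  have hlt := treeEdge_lt h
  -- Otherwise e would contain all three vertices, against its cardinality 2.
  have key : e ⊆ {(treeEdge m).1, (treeEdge m).2} ∨ e ⊆ {(treeEdge m).1, m} ∨
      e ⊆ {(treeEdge m).2, m} := by
    by_contra! hcon
    have hall : treeFace m ⊆ e := by
      intro x hx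
      by_contra hxe
      have h' : ∀ y ∈ e, (y = (treeEdge m).1 ∨ y = (treeEdge m).2 ∨ y = m) ∧ y ≠ x := by
        intro y hy
        refine ⟨by simpa [treeFace] using he hy, fun h => hxe (h ▸ hy)⟩
      simp only [treeFace, Finset.mem_insert, Finset.mem_singleton] at hx
      rcases hx with rfl | rfl | rfl
      · refine hcon.2.2 fun y hy => ?_
        have := h' y hy; simp only [Finset.mem_insert, Finset.mem_singleton]; tauto
      · refine hcon.2.1 fun y hy => ?_
        have := h' y hy; simp only [Finset.mem_insert, Finset.mem_singleton]; tauto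
      · refine hcon.1 fun y hy => ?_
        have := h' y hy; simp only [Finset.mem_insert, Finset.mem_singleton]; tauto
    have := Finset.card_le_card hall
    rw [card_treeFace h] at this
    omega
  rcases key with hk | hk | hk
  · by_cases h2 : m = 2
    · subst h2
      refine ⟨3, by omega, by omega, by omega, hk.trans ?_⟩
      simp [treeFace, treeEdge_of_lt, Finset.insert_subset_iff]
    by_cases h3 : m = 3
    · subst h3
      refine ⟨2, by omega, by omega, by omega, hk.trans ?_⟩
      simp [treeFace, treeEdge_of_lt, Finset.insert_subset_iff]
    refine ⟨m / 2, by omega, by omega, by omega, hk.trans ?_⟩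
    obtain ⟨i, rfl | rfl⟩ := Nat.even_or_odd' m
    · rw [treeEdge_two_mul (by omega), show 2 * i / 2 = i by omega]
      simp [treeFace, Finset.insert_subset_iff]
    · rw [treeEdge_two_mul_add_one (by omega), show (2 * i + 1) / 2 = i by omega]
      simp [treeFace]
  · refine ⟨2 * m, by omega, by omega, by omega, hk.trans ?_⟩
    simp [treeFace, treeEdge_two_mul h, Finset.insert_subset_iff]
  · refine ⟨2 * m + 1, by omega, by omega, by omega, hk.trans ?_⟩
    simp [treeFace, treeEdge_two_mul_add_one h, Finset.insert_subset_iff]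

/-- If a set system contains an injective image of the triangulated tree of depth `k`, then the
central triangle survives `k` collapses. -/
theorem core_nonempty_of_tree {V : Type*} [DecidableEq V] {S : Set (Finset V)} {k : ℕ}
    (φ : ℕ → V) (hφ : Set.InjOn φ {x | x < 3 * 2 ^ k})
    (hS : ∀ m, 2 ≤ m → m < 3 * 2 ^ k → (treeFace m).image φ ∈ S) :
    (core^[k] S).Nonempty := by
  -- Each collapse halves the range of labels known to survive; after k of them the range is m < 3,
  -- which leaves the central triangle 2.
  have key : ∀ j ≤ k, ∀ m, 2 ≤ m → m < 3 * 2 ^ (k - j) → (treeFace m).image φ ∈ core^[j] S := by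
    intro j
    induction j with
    | zero => exact fun _ m h1 h2 => hS m h1 h2
    | succ j ih =>
      intro hj m h1 h2
      have hpow : 3 * 2 ^ (k - j) = 2 * (3 * 2 ^ (k - (j + 1))) := by
        rw [show k - j = (k - (j + 1)) + 1 by omega, pow_succ]; ring
      have hle : 3 * 2 ^ (k - j) ≤ 3 * 2 ^ k :=
        Nat.mul_le_mul_left _ (Nat.pow_le_pow_right two_pos (Nat.sub_le _ _))
      rw [Function.iterate_succ_apply']
      refine ⟨ih (by omega) m h1 (by omega), fun e he hc => ?_⟩
      obtain ⟨e', he', rfl⟩ := Finset.subset_image_iff.1 he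
      have hinj : Set.InjOn φ ↑(treeFace m) := hφ.mono fun x hx => by
        have := le_of_mem_treeFace h1 hx
        simp only [Set.mem_ofPred_eq]; omega
      rw [Finset.card_image_of_injOn (hinj.mono he')] at hc
      obtain ⟨i, hi1, hi2, hi3, hi4⟩ := exists_ne_treeFace_superset h1 he' hc
      refine ⟨_, ih (by omega) i hi1 (by omega), ?_, Finset.image_subset_image hi4⟩
      intro heq
      refine hi3 (treeFace_injOn hi1 h1 ?_)
      have h5 : ∀ m', 2 ≤ m' → m' < 3 * 2 ^ k → ∀ x ∈ treeFace m', x < 3 * 2 ^ k :=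
        fun m' h6 h7 x hx => (le_of_mem_treeFace h6 hx).trans_lt h7
      have h8 : (treeFace i : Set ℕ) = treeFace m :=
        (hφ.image_eq_image_iff (h5 i hi1 (by omega)) (h5 m h1 (by omega))).1
          (by rw [← Finset.coe_image, ← Finset.coe_image, heq])
      exact_mod_cast h8
  exact ⟨_, key k le_rfl 2 le_rfl (by simp)⟩

/-- Any nonempty set of triangles of the triangulated tree spans at least two vertices more than
it has triangles. -/
theorem card_add_two_le_card_biUnion_treeFace {M : Finset ℕ} (hM : M.Nonempty)
    (h2 : ∀ m ∈ M, 2 ≤ m) : M.card + 2 ≤ (M.biUnion treeFace).card := by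
  have h0 := M.min'_mem hM
  set m := M.min' hM
  have hlt := treeEdge_lt (h2 m h0)
  -- The top vertices of the triangles form M itself, and the base of the lowest triangle supplies
  -- two vertices below all of them.
  have hd : Disjoint M {(treeEdge m).1, (treeEdge m).2} := by
    rw [Finset.disjoint_left]
    intro x hx hx'
    have : m ≤ x := M.min'_le x hx
    simp only [Finset.mem_insert, Finset.mem_singleton] at hx'
    omega
  rw [← Finset.card_pair hlt.1.ne, ← Finset.card_union_of_disjoint hd]
  refine Finset.card_le_card (Finset.union_subset ?_ ?_)
  · exact fun x hx => Finset.mem_biUnion.2 ⟨x, hx, mem_treeFace_self x⟩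
  · refine fun x hx => Finset.mem_biUnion.2 ⟨m, h0, ?_⟩
    simp only [Finset.mem_insert, Finset.mem_singleton] at hx
    simp only [treeFace, Finset.mem_insert, Finset.mem_singleton]
    tauto

/-! ### The random complex as a random set of triangles; moment inequalities -/

section Probability

variable {n : ℕ}

theorem LMComplex.dimLETwo (Y : LMComplex n) : DimLETwo Y.1 := fun _ hs => (Y.2.2 hs).2

open Classical in
/-- The finite set of 2-simplexes of `Y`. -/
noncomputable def triangleFinset (Y : LMComplex n) : Finset (Finset (Fin n)) :=
  Finset.univ.filter (· ∈ triangles Y.1)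

theorem coe_triangleFinset (Y : LMComplex n) : (triangleFinset Y : Set _) = triangles Y.1 := by
  ext s; simp [triangleFinset]

theorem mem_triangleFinset {Y : LMComplex n} {s : Finset (Fin n)} :
    s ∈ triangleFinset Y ↔ s ∈ triangles Y.1 := by simp [triangleFinset]

theorem mem_faces_iff (Y : LMComplex n) (s : Finset (Fin n)) :
    s ∈ Y.1.faces ↔ (s.Nonempty ∧ s.card ≤ 2) ∨ s ∈ triangleFinset Y := by
  rw [mem_triangleFinset]
  constructor
  · intro hs
    have h := Y.2.2 hs
    rcases Nat.lt_or_ge s.card 3 with h3 | h3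
    · exact Or.inl ⟨h.1, by omega⟩
    · exact Or.inr ⟨hs, le_antisymm h.2 h3⟩
  · rintro (h | h)
    · exact Y.2.1 h
    · exact h.1

theorem triangleFinset_injective : Function.Injective (triangleFinset (n := n)) := by
  intro Y Z h
  refine Subtype.ext (PreAbstractSimplicialComplex.ext ?_)
  ext s
  rw [mem_faces_iff, mem_faces_iff, h]

theorem exists_triangleFinset_eq {S : Finset (Finset (Fin n))}
    (hS : S ⊆ Finset.powersetCard 3 Finset.univ) : ∃ Y : LMComplex n, triangleFinset Y = S := by
  have h3 : ∀ s ∈ S, s.card = 3 := fun s hs => (Finset.mem_powersetCard.1 (hS hs)).2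
  have hrel : IsRelLowerSet {s | (s.Nonempty ∧ s.card ≤ 2) ∨ s ∈ S} Finset.Nonempty := by
    rintro s hs
    refine ⟨?_, fun t hts hne => ?_⟩
    · rcases hs with hs | hs
      · exact hs.1
      · exact Finset.card_pos.1 (by rw [h3 s hs]; omega)
    · rcases hs with hs | hs
      · exact Or.inl ⟨hne, (Finset.card_le_card hts).trans hs.2⟩
      · rcases Nat.lt_or_ge t.card 3 with h | h
        · exact Or.inl ⟨hne, by omega⟩
        · rw [Finset.eq_of_subset_of_card_le hts (by rw [h3 s hs]; exact h)]
          exact Or.inr hs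
  refine ⟨⟨⟨_, hrel⟩, ?_, ?_⟩, ?_⟩
  · exact fun _ hs => Or.inl hs
  · rintro s (hs | hs)
    · exact ⟨hs.1, hs.2.trans (by omega)⟩
    · exact ⟨Finset.card_pos.1 (by rw [h3 s hs]; omega), (h3 s hs).le⟩
  · ext s
    refine mem_triangleFinset.trans ⟨?_, ?_⟩
    · rintro ⟨hs | hs, hc⟩
      · have := hs.2; omega
      · exact hs
    · exact fun hs => ⟨Or.inr hs, h3 s hs⟩

theorem triangleFinset_subset (Y : LMComplex n) :
    triangleFinset Y ⊆ Finset.powersetCard 3 Finset.univ := fun _ hs =>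
  Finset.mem_powersetCard.2 ⟨Finset.subset_univ _, (mem_triangleFinset.1 hs).2⟩

theorem faceCount_eq (Y : LMComplex n) : faceCount Y = (triangleFinset Y).card := by
  rw [faceCount, ← coe_triangleFinset, Set.ncard_coe_finset]

-- Outcomes containing F correspond to arbitrary sets of the remaining triangles, and by the
-- binomial theorem their weights sum to `p ^ F.card` times a power of p + (1 - p).
open Classical in
theorem eventProb_subset (p : ℝ) {F : Finset (Finset (Fin n))}
    (hF : F ⊆ Finset.powersetCard 3 Finset.univ) :
    eventProb p {Y : LMComplex n | F ⊆ triangleFinset Y} = p ^ F.card := by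
  set U : Finset (Finset (Fin n)) := Finset.powersetCard 3 Finset.univ
  have hU : U.card = n.choose 3 := by simp [U]
  have h1 : eventProb p {Y : LMComplex n | F ⊆ triangleFinset Y} =
      ∑ Y ∈ (Finset.univ : Finset (LMComplex n)).filter (fun Y => F ⊆ triangleFinset Y),
        outcomeProb p Y := by
    rw [eventProb, Finset.sum_filter]
    exact Finset.sum_congr rfl fun Y _ => by simp [Set.indicator_apply]
  have h2 : ∑ Y ∈ (Finset.univ : Finset (LMComplex n)).filter (fun Y => F ⊆ triangleFinset Y),
        outcomeProb p Y =
      ∑ t ∈ (U \ F).powerset, p ^ F.card * (p ^ t.card * (1 - p) ^ ((U \ F).card - t.card)) := by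
    refine Finset.sum_bij (fun Y _ => triangleFinset Y \ F) ?_ ?_ ?_ ?_
    · intro Y _
      exact Finset.mem_powerset.2 (Finset.sdiff_subset_sdiff (triangleFinset_subset Y) subset_rfl)
    · intro Y hY Z hZ h
      refine triangleFinset_injective ?_
      rw [← Finset.sdiff_union_of_subset (Finset.mem_filter.1 hY).2,
        ← Finset.sdiff_union_of_subset (Finset.mem_filter.1 hZ).2, h]
    · intro t ht
      rw [Finset.mem_powerset, Finset.subset_sdiff] at ht
      obtain ⟨Y, hY⟩ := exists_triangleFinset_eq (Finset.union_subset ht.1 hF)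
      refine ⟨Y, Finset.mem_filter.2 ⟨Finset.mem_univ _, ?_⟩, ?_⟩
      · rw [hY]; exact Finset.subset_union_right
      · rw [hY, Finset.union_sdiff_cancel_right ht.2]
    · intro Y hY
      have hFY := (Finset.mem_filter.1 hY).2
      have e1 := Finset.card_sdiff_add_card_eq_card hFY
      have e2 := Finset.card_sdiff_add_card_eq_card hF
      rw [outcomeProb, faceCount_eq, ← hU, ← mul_assoc, ← pow_add]
      congr 2 <;> omega
  rw [h1, h2, ← Finset.mul_sum, Finset.sum_pow_mul_eq_add_pow]
  simp

theorem eventProb_univ (p : ℝ) : eventProb p (Set.univ : Set (LMComplex n)) = 1 := by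
  have := eventProb_subset (n := n) p (F := ∅) (Finset.empty_subset _)
  simpa using this

theorem eventProb_compl (p : ℝ) (A : Set (LMComplex n)) :
    eventProb p Aᶜ = 1 - eventProb p A := by
  rw [← eventProb_univ (n := n) p, eventProb, eventProb, eventProb, ← Finset.sum_sub_distrib]
  refine Finset.sum_congr rfl fun Y _ => ?_
  by_cases h : Y ∈ A <;> simp [h]

theorem outcomeProb_nonneg {p : ℝ} (h0 : 0 ≤ p) (h1 : p ≤ 1) (Y : LMComplex n) :
    0 ≤ outcomeProb p Y :=
  mul_nonneg (pow_nonneg h0 _) (pow_nonneg (sub_nonneg.2 h1) _)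

theorem eventProb_nonneg {p : ℝ} (h0 : 0 ≤ p) (h1 : p ≤ 1) (A : Set (LMComplex n)) :
    0 ≤ eventProb p A :=
  Finset.sum_nonneg fun _ _ => Set.indicator_nonneg (fun _ _ => outcomeProb_nonneg h0 h1 _) _

theorem eventProb_mono {p : ℝ} (h0 : 0 ≤ p) (h1 : p ≤ 1) {A B : Set (LMComplex n)}
    (h : A ⊆ B) : eventProb p A ≤ eventProb p B :=
  Finset.sum_le_sum fun _ _ =>
    Set.indicator_le_indicator_of_subset h (fun _ => outcomeProb_nonneg h0 h1 _) _

theorem eventProb_union_le {p : ℝ} (h0 : 0 ≤ p) (h1 : p ≤ 1) (A B : Set (LMComplex n)) :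
    eventProb p (A ∪ B) ≤ eventProb p A + eventProb p B := by
  rw [eventProb, eventProb, eventProb, ← Finset.sum_add_distrib]
  refine Finset.sum_le_sum fun Y _ => ?_
  have := outcomeProb_nonneg h0 h1 Y
  by_cases hA : Y ∈ A <;> by_cases hB : Y ∈ B <;> simp [hA, hB, this]

theorem eventProb_biUnion_le {ι : Type*} {p : ℝ} (h0 : 0 ≤ p) (h1 : p ≤ 1) (I : Finset ι)
    (B : ι → Set (LMComplex n)) :
    eventProb p {Y | ∃ i ∈ I, Y ∈ B i} ≤ ∑ i ∈ I, eventProb p (B i) := by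
  classical
  induction I using Finset.induction_on with
  | empty => simp [eventProb]
  | insert i I hi ih =>
    rw [Finset.sum_insert hi]
    refine le_trans ?_ ((eventProb_union_le h0 h1 (B i) {Y | ∃ i ∈ I, Y ∈ B i}).trans
      (add_le_add_right ih _))
    refine eventProb_mono h0 h1 ?_
    rintro Y ⟨j, hj, hY⟩
    rcases Finset.mem_insert.1 hj with rfl | hj
    · exact Or.inl hY
    · exact Or.inr ⟨j, hj, hY⟩

/-- First moment bound for the existence of `f` triangles spanning at most `v` vertices. -/
theorem eventProb_exists_dense_le {p : ℝ} (h0 : 0 ≤ p) (h1 : p ≤ 1) {v : ℕ} (hv : v ≤ n)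
    (f : ℕ) :
    eventProb p {Y : LMComplex n | ∃ F : Finset (Finset (Fin n)), F ⊆ triangleFinset Y ∧
      F.card = f ∧ (F.biUnion id).card ≤ v} ≤ ((v.choose 3).choose f : ℕ) * (n ^ v * p ^ f) := by
  classical
  set I : Finset (Finset (Finset (Fin n))) :=
    (Finset.powersetCard v Finset.univ).biUnion
      fun W => Finset.powersetCard f (Finset.powersetCard 3 W)
  have hI : I.card ≤ n ^ v * (v.choose 3).choose f := by
    refine (Finset.card_biUnion_le_card_mul _ _ ((v.choose 3).choose f) fun W hW => ?_).trans ?_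
    · rw [Finset.card_powersetCard, Finset.card_powersetCard, (Finset.mem_powersetCard.1 hW).2]
    · rw [Finset.card_powersetCard, Finset.card_univ, Fintype.card_fin]
      exact Nat.mul_le_mul_right _ (Nat.choose_le_pow n v)
  have h2 : ∀ F ∈ I, eventProb p {Y : LMComplex n | F ⊆ triangleFinset Y} ≤ p ^ f := by
    intro F hF
    obtain ⟨W, -, hF⟩ := Finset.mem_biUnion.1 hF
    obtain ⟨hF, hc⟩ := Finset.mem_powersetCard.1 hF
    rw [eventProb_subset p (hF.trans (Finset.powersetCard_mono (Finset.subset_univ _))), hc]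
  calc _ ≤ eventProb p {Y : LMComplex n | ∃ F ∈ I, Y ∈ {Y | F ⊆ triangleFinset Y}} := by
        refine eventProb_mono h0 h1 ?_
        rintro Y ⟨F, hF, hc, hFv⟩
        -- Padding the vertex set to exactly v elements lets the union bound run over v-subsets
        -- only; this is where v ≤ n is needed.
        obtain ⟨W, hW, -, hWc⟩ := Finset.exists_subsuperset_card_eq
          (Finset.subset_univ (F.biUnion id)) hFv (by simpa using hv)
        refine ⟨F, Finset.mem_biUnion.2 ⟨W, Finset.mem_powersetCard.2
          ⟨Finset.subset_univ _, hWc⟩, Finset.mem_powersetCard.2 ⟨fun s hs => ?_, hc⟩⟩, hF⟩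
        refine Finset.mem_powersetCard.2 ⟨?_, (mem_triangleFinset.1 (hF hs)).2⟩
        exact (Finset.subset_biUnion_of_mem id hs).trans hW
    _ ≤ ∑ F ∈ I, eventProb p {Y : LMComplex n | F ⊆ triangleFinset Y} :=
        eventProb_biUnion_le h0 h1 I _
    _ ≤ I.card • p ^ f := Finset.sum_le_card_nsmul _ _ _ h2
    _ ≤ _ := by
        rw [nsmul_eq_mul]
        have : (I.card : ℝ) ≤ n ^ v * ((v.choose 3).choose f : ℕ) := by exact_mod_cast hI
        calc _ ≤ ((n : ℝ) ^ v * ((v.choose 3).choose f : ℕ)) * p ^ f :=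
              mul_le_mul_of_nonneg_right this (pow_nonneg h0 _)
          _ = _ := by ring

/-- Chebyshev's inequality for a sum of indicators. -/
theorem eventProb_forall_not_mul_sq_le {ι : Type*} {p : ℝ} (h0 : 0 ≤ p) (h1 : p ≤ 1)
    (I : Finset ι) (B : ι → Set (LMComplex n)) :
    eventProb p {Y | ∀ i ∈ I, Y ∉ B i} * (∑ i ∈ I, eventProb p (B i)) ^ 2 ≤
      ∑ i ∈ I, ∑ j ∈ I, eventProb p (B i ∩ B j) - (∑ i ∈ I, eventProb p (B i)) ^ 2 := by
  classical
  set μ := ∑ i ∈ I, eventProb p (B i)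
  set X : LMComplex n → ℝ := fun Y => ∑ i ∈ I, (B i).indicator 1 Y
  have hX1 : ∑ Y, outcomeProb p Y * X Y = μ := by
    simp only [X, μ, Finset.mul_sum, eventProb]
    rw [Finset.sum_comm]
    refine Finset.sum_congr rfl fun i _ => Finset.sum_congr rfl fun Y _ => ?_
    by_cases h : Y ∈ B i <;> simp [h]
  have hX2 : ∑ Y, outcomeProb p Y * X Y ^ 2 = ∑ i ∈ I, ∑ j ∈ I, eventProb p (B i ∩ B j) := by
    have hY : ∀ Y, outcomeProb p Y * X Y ^ 2 =
        ∑ i ∈ I, ∑ j ∈ I, (B i ∩ B j).indicator (outcomeProb p) Y := by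
      intro Y
      simp only [X, sq, Finset.sum_mul_sum]
      rw [Finset.mul_sum]
      refine Finset.sum_congr rfl fun i _ => ?_
      rw [Finset.mul_sum]
      refine Finset.sum_congr rfl fun j _ => ?_
      by_cases h : Y ∈ B i <;> by_cases h' : Y ∈ B j <;> simp [h, h']
    simp only [hY, eventProb]
    rw [Finset.sum_comm]
    exact Finset.sum_congr rfl fun i _ => Finset.sum_comm
  have hX0 : ∑ Y : LMComplex n, outcomeProb p Y = 1 := by
    rw [← eventProb_univ (n := n) p]; simp [eventProb]
  have hvar : ∑ Y, outcomeProb p Y * (X Y - μ) ^ 2 =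
      ∑ i ∈ I, ∑ j ∈ I, eventProb p (B i ∩ B j) - μ ^ 2 := by
    rw [← hX2]
    have : ∀ Y, outcomeProb p Y * (X Y - μ) ^ 2 = outcomeProb p Y * X Y ^ 2
        - 2 * μ * (outcomeProb p Y * X Y) + μ ^ 2 * outcomeProb p Y := fun Y => by ring
    simp only [this, Finset.sum_add_distrib, Finset.sum_sub_distrib, ← Finset.mul_sum, hX1, hX0]
    ring
  rw [← hvar, eventProb, Finset.sum_mul]
  refine Finset.sum_le_sum fun Y _ => ?_
  -- On the event X = 0, so the variance integrand is μ²; elsewhere it is nonnegative.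
  by_cases h : Y ∈ {Y | ∀ i ∈ I, Y ∉ B i}
  · have hX : X Y = 0 := Finset.sum_eq_zero fun i hi => by
      rw [Set.indicator_of_notMem (h i hi)]
    rw [Set.indicator_of_mem h, hX, zero_sub, neg_sq]
  · rw [Set.indicator_of_notMem h, zero_mul]
    exact mul_nonneg (outcomeProb_nonneg h0 h1 Y) (sq_nonneg _)

end Probability

/-! ### Counting embedded copies of a fixed family of triangles -/

section SecondMoment

variable {n : ℕ} {V : Type*}

/-- The image of a family of sets under an embedding. -/
def mapFamily (T : Finset (Finset V)) (φ : V ↪ Fin n) : Finset (Finset (Fin n)) :=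
  T.map (Finset.mapEmbedding φ).toEmbedding

theorem mem_mapFamily {T : Finset (Finset V)} {φ : V ↪ Fin n} {s : Finset (Fin n)} :
    s ∈ mapFamily T φ ↔ ∃ t ∈ T, t.map φ = s := by simp [mapFamily]

theorem card_mapFamily (T : Finset (Finset V)) (φ : V ↪ Fin n) :
    (mapFamily T φ).card = T.card := Finset.card_map _

theorem mapFamily_subset {T : Finset (Finset V)} (h3 : ∀ t ∈ T, t.card = 3) (φ : V ↪ Fin n) :
    mapFamily T φ ⊆ Finset.powersetCard 3 Finset.univ := by
  intro s hs
  obtain ⟨t, ht, rfl⟩ := mem_mapFamily.1 hs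
  exact Finset.mem_powersetCard.2 ⟨Finset.subset_univ _, by rw [Finset.card_map, h3 t ht]⟩

theorem card_mapFamily_union [DecidableEq V] (T : Finset (Finset V)) (φ ψ : V ↪ Fin n) :
    (mapFamily T φ ∪ mapFamily T ψ).card =
      T.card + (T.card - (T.filter (fun t => t.map ψ ∈ mapFamily T φ)).card) := by
  have h : mapFamily T ψ \ mapFamily T φ =
      mapFamily (T.filter (fun t => ¬ t.map ψ ∈ mapFamily T φ)) ψ := by
    ext s
    rw [Finset.mem_sdiff, mem_mapFamily (T := T) (φ := ψ), mem_mapFamily (φ := ψ)]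
    constructor
    · rintro ⟨⟨t, ht, rfl⟩, hs⟩
      exact ⟨t, Finset.mem_filter.2 ⟨ht, hs⟩, rfl⟩
    · rintro ⟨t, ht, rfl⟩
      exact ⟨⟨t, (Finset.mem_filter.1 ht).1, rfl⟩, (Finset.mem_filter.1 ht).2⟩
  rw [← Finset.union_sdiff_self_eq_union, Finset.card_union_of_disjoint Finset.disjoint_sdiff, h,
    card_mapFamily, card_mapFamily]
  have := Finset.card_filter_add_card_filter_not (s := T) (fun t => t.map ψ ∈ mapFamily T φ)
  omega

/-- The number of embeddings whose overlap with a given embedding is prescribed. -/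
theorem card_overlap_le [Fintype V] [DecidableEq V] (T A : Finset (Finset V)) (φ : V ↪ Fin n) (hn : 1 ≤ n) {m : ℕ}
    (hm : m ≤ (A.biUnion id).card) :
    (Finset.univ.filter
      (fun ψ : V ↪ Fin n => T.filter (fun t => t.map ψ ∈ mapFamily T φ) = A)).card ≤
      Fintype.card V ^ Fintype.card V * n ^ (Fintype.card V - m) := by
  classical
  set W := A.biUnion id
  have hW : W.card ≤ Fintype.card V := Finset.card_le_univ W
  calc _ ≤ (Fintype.piFinset fun x : V =>
        if x ∈ W then Finset.univ.map φ else (Finset.univ : Finset (Fin n))).card := by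
        refine Finset.card_le_card_of_injOn (fun ψ => ⇑ψ) ?_
          (fun _ _ _ _ h => DFunLike.coe_injective h)
        intro ψ hψ
        have hψ : T.filter (fun t => t.map ψ ∈ mapFamily T φ) = A := by simpa using hψ
        rw [Finset.mem_coe, Fintype.mem_piFinset]
        intro x
        -- A vertex of an overlapping triangle must land in the image of φ, which leaves at most |V|
        -- choices; every other vertex has n.
        split_ifs with hx
        · obtain ⟨t, ht, hxt⟩ := Finset.mem_biUnion.1 hx
          rw [← hψ, Finset.mem_filter] at ht
          obtain ⟨u, -, hu⟩ := mem_mapFamily.1 ht.2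
          have : ψ x ∈ t.map ψ := Finset.mem_map_of_mem _ hxt
          rw [← hu] at this
          exact Finset.map_subset_map.2 (Finset.subset_univ u) this
        · exact Finset.mem_univ _
    _ = Fintype.card V ^ W.card * n ^ (Fintype.card V - W.card) := by
        rw [Fintype.card_piFinset]
        simp only [apply_ite Finset.card, Finset.card_map, Finset.card_univ, Fintype.card_fin]
        rw [Finset.prod_ite, Finset.prod_const, Finset.prod_const, Finset.filter_not,
          Finset.filter_mem_eq_inter, Finset.univ_inter, Finset.card_sdiff_of_subset
          (Finset.subset_univ _), Finset.card_univ]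
    _ ≤ _ := by
        rcases Nat.eq_zero_or_pos (Fintype.card V) with h | h
        · have : W.card = 0 := by omega
          rw [this, h]; simp
        · exact Nat.mul_le_mul (Nat.pow_le_pow_right h hW)
            (Nat.pow_le_pow_right hn (by omega))

/-- The embeddings ψ are sorted by the subfamily A of T that they send into the copy given by φ. The
term A = ∅ is kept apart because, summed over φ, it is cancelled by the squared mean. -/
theorem sum_eventProb_inter_le [Fintype V] [DecidableEq V] {p : ℝ} (h0 : 0 ≤ p) {T : Finset (Finset V)}
    (h3 : ∀ t ∈ T, t.card = 3)
    (hT : ∀ A ⊆ T, A.Nonempty → A.card + 2 ≤ (A.biUnion id).card) (hn : 1 ≤ n) (φ : V ↪ Fin n) :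
    ∑ ψ : V ↪ Fin n, eventProb p ({Y | mapFamily T φ ⊆ triangleFinset Y} ∩
      {Y | mapFamily T ψ ⊆ triangleFinset Y}) ≤
    p ^ T.card * (Fintype.card (V ↪ Fin n) * p ^ T.card + ∑ A ∈ T.powerset.erase ∅,
      (Fintype.card V : ℝ) ^ Fintype.card V * n ^ (Fintype.card V - (A.card + 2)) *
        p ^ (T.card - A.card)) := by
  classical
  set ov : (V ↪ Fin n) → Finset (Finset V) :=
    fun ψ => T.filter (fun t => t.map ψ ∈ mapFamily T φ)
  have h1 : ∀ ψ : V ↪ Fin n, eventProb p ({Y | mapFamily T φ ⊆ triangleFinset Y} ∩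
      {Y | mapFamily T ψ ⊆ triangleFinset Y}) = p ^ T.card * p ^ (T.card - (ov ψ).card) := by
    intro ψ
    rw [← pow_add, ← card_mapFamily_union T φ ψ, ← eventProb_subset p
      (Finset.union_subset (mapFamily_subset h3 φ) (mapFamily_subset h3 ψ))]
    congr 1
    ext Y
    simp [Finset.union_subset_iff]
  simp only [h1, ← Finset.mul_sum]
  refine mul_le_mul_of_nonneg_left ?_ (pow_nonneg h0 _)
  rw [← Finset.sum_fiberwise_of_maps_to (s := Finset.univ) (t := T.powerset) (g := ov)
    (fun ψ _ => Finset.mem_powerset.2 (Finset.filter_subset _ _)),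
    ← Finset.add_sum_erase _ _ (Finset.empty_mem_powerset T)]
  have h2 : ∀ A, ∑ ψ with ov ψ = A, p ^ (T.card - (ov ψ).card) =
      (Finset.univ.filter (fun ψ => ov ψ = A)).card * p ^ (T.card - A.card) := by
    intro A
    rw [← nsmul_eq_mul, ← Finset.sum_const]
    exact Finset.sum_congr rfl fun ψ hψ => by rw [(Finset.mem_filter.1 hψ).2]
  refine add_le_add ?_ (Finset.sum_le_sum fun A hA => ?_)
  · rw [h2, Finset.card_empty, Nat.sub_zero]
    refine mul_le_mul_of_nonneg_right ?_ (pow_nonneg h0 _)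
    exact_mod_cast Finset.card_le_univ _
  · rw [h2]
    obtain ⟨hne, hA⟩ := Finset.mem_erase.1 hA
    refine mul_le_mul_of_nonneg_right ?_ (pow_nonneg h0 _)
    exact_mod_cast card_overlap_le T A φ hn
      (hT A (Finset.mem_powerset.1 hA) (Finset.nonempty_iff_ne_empty.2 hne))

/-- Each factor of the falling factorial counting embeddings is at least n/2. -/
theorem pow_card_le_two_pow_mul_card_embedding [Fintype V] (hn : 2 * Fintype.card V ≤ n) :
    (n : ℝ) ^ Fintype.card V ≤ 2 ^ Fintype.card V * Fintype.card (V ↪ Fin n) := by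
  rw [Fintype.card_embedding_eq, Fintype.card_fin]
  have h1 := Nat.pow_sub_le_descFactorial n (Fintype.card V)
  have h2 : n ^ Fintype.card V ≤ (2 * (n + 1 - Fintype.card V)) ^ Fintype.card V :=
    Nat.pow_le_pow_left (by omega) _
  rw [mul_pow] at h2
  exact_mod_cast h2.trans (Nat.mul_le_mul_left _ h1)

/-- Second moment bound for the probability that `Y` contains no copy of the 2-complex with
triangles `T`. -/
theorem eventProb_forall_not_mapFamily_le [Fintype V] [DecidableEq V] {p : ℝ} (h0 : 0 < p) (h1 : p ≤ 1)
    {T : Finset (Finset V)} (h3 : ∀ t ∈ T, t.card = 3)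
    (hT : ∀ A ⊆ T, A.Nonempty → A.card + 2 ≤ (A.biUnion id).card) (hn : 1 ≤ n)
    (hnV : 2 * Fintype.card V ≤ n) :
    eventProb p {Y : LMComplex n | ∀ φ : V ↪ Fin n, ¬ mapFamily T φ ⊆ triangleFinset Y} ≤
      ∑ A ∈ T.powerset.erase ∅,
        (2 * Fintype.card V : ℝ) ^ Fintype.card V / (n ^ (A.card + 2) * p ^ A.card) := by
  classical
  set N := Fintype.card V
  set D := (Fintype.card (V ↪ Fin n) : ℝ)
  set f := T.card
  set R := ∑ A ∈ T.powerset.erase ∅, (N : ℝ) ^ N * n ^ (N - (A.card + 2)) * p ^ (f - A.card)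
  have hn0 : (0 : ℝ) < n := by exact_mod_cast hn
  have hnD : (n : ℝ) ^ N ≤ 2 ^ N * D := pow_card_le_two_pow_mul_card_embedding hnV
  have hD : 0 < D := by
    have : 0 < 2 ^ N * D := (pow_pos hn0 N).trans_le hnD
    exact pos_of_mul_pos_right this (by positivity)
  have hpf : 0 < p ^ f := pow_pos h0 f
  have hmu : ∑ φ : V ↪ Fin n, eventProb p {Y | mapFamily T φ ⊆ triangleFinset Y} = D * p ^ f := by
    simp only [eventProb_subset p (mapFamily_subset h3 _), card_mapFamily, Finset.sum_const,
      nsmul_eq_mul, Finset.card_univ]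
    rfl
  have hcheb := eventProb_forall_not_mul_sq_le h0.le h1 (Finset.univ : Finset (V ↪ Fin n))
    (fun φ => {Y : LMComplex n | mapFamily T φ ⊆ triangleFinset Y})
  have hsq : ∑ φ : V ↪ Fin n, ∑ ψ : V ↪ Fin n,
      eventProb p ({Y | mapFamily T φ ⊆ triangleFinset Y} ∩
        {Y | mapFamily T ψ ⊆ triangleFinset Y}) ≤ D * (p ^ f * (D * p ^ f + R)) := by
    refine (Finset.sum_le_card_nsmul _ _ _
      fun φ _ => sum_eventProb_inter_le h0.le h3 hT hn φ).trans_eq ?_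
    rw [nsmul_eq_mul, Finset.card_univ]
  rw [hmu] at hcheb
  simp only [Finset.mem_univ, forall_const, Set.mem_ofPred_eq] at hcheb
  set P := eventProb p {Y : LMComplex n | ∀ φ : V ↪ Fin n, ¬ mapFamily T φ ⊆ triangleFinset Y}
  -- With mean D p^f, Chebyshev's bound reads P (D p^f)² ≤ D p^f R after the disjoint pairs cancel.
  have hP : P ≤ R / (D * p ^ f) := by
    rw [le_div_iff₀ (mul_pos hD hpf)]
    refine le_of_mul_le_mul_right ?_ (mul_pos hD hpf)
    nlinarith
  refine hP.trans ?_
  rw [Finset.sum_div]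
  refine Finset.sum_le_sum fun A hA => ?_
  obtain ⟨hne, hA⟩ := Finset.mem_erase.1 hA
  rw [Finset.mem_powerset] at hA
  have hA1 : A.card ≤ f := Finset.card_le_card hA
  have hA2 : A.card + 2 ≤ N := (hT A hA (Finset.nonempty_iff_ne_empty.2 hne)).trans
    (Finset.card_le_univ _)
  rw [div_le_div_iff₀ (by positivity) (by positivity)]
  calc _ = (N : ℝ) ^ N * (n ^ (N - (A.card + 2)) * n ^ (A.card + 2)) *
        (p ^ (f - A.card) * p ^ A.card) := by ring
    _ = (N : ℝ) ^ N * n ^ N * p ^ f := by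
        rw [← pow_add, ← pow_add, Nat.sub_add_cancel hA2, Nat.sub_add_cancel hA1]
    _ ≤ (N : ℝ) ^ N * (2 ^ N * D) * p ^ f := by gcongr
    _ = _ := by rw [mul_pow]; ring

end SecondMoment

/-! ### The finite tree as a family to be embedded -/

/-- The triangle `treeFace m` as a set of vertices in `Fin N`. -/
def finTreeFace (N m : ℕ) : Finset (Fin N) := Finset.univ.filter (fun x => x.val ∈ treeFace m)

/-- The triangles of the triangulated tree with `N` vertices. -/
def finTree (N : ℕ) : Finset (Finset (Fin N)) := (Finset.Ico 2 N).image (finTreeFace N)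

theorem map_finTreeFace {N m : ℕ} (h2 : 2 ≤ m) (hm : m < N) :
    (finTreeFace N m).map Fin.valEmbedding = treeFace m := by
  ext x
  simp only [finTreeFace, Finset.mem_map, Finset.mem_filter, Finset.mem_univ, true_and,
    Fin.valEmbedding_apply]
  constructor
  · rintro ⟨y, hy, rfl⟩; exact hy
  · exact fun hx => ⟨⟨x, (le_of_mem_treeFace h2 hx).trans_lt hm⟩, hx, rfl⟩

theorem card_of_mem_finTree {N : ℕ} : ∀ t ∈ finTree N, t.card = 3 := by
  intro t ht
  obtain ⟨m, hm, rfl⟩ := Finset.mem_image.1 ht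
  rw [Finset.mem_Ico] at hm
  rw [← Finset.card_map Fin.valEmbedding, map_finTreeFace hm.1 hm.2, card_treeFace hm.1]

theorem card_finTree_le (N : ℕ) : (finTree N).card ≤ N - 2 :=
  Finset.card_image_le.trans (by simp)

theorem card_add_two_le_of_subset_finTree {N : ℕ} :
    ∀ A ⊆ finTree N, A.Nonempty → A.card + 2 ≤ (A.biUnion id).card := by
  intro A hA hne
  obtain ⟨M, hM, rfl⟩ := Finset.subset_image_iff.1 hA
  have hM' : ∀ m ∈ M, 2 ≤ m ∧ m < N := fun m hm => Finset.mem_Ico.1 (hM hm)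
  have h1 := card_add_two_le_card_biUnion_treeFace (Finset.image_nonempty.1 hne)
    (fun m hm => (hM' m hm).1)
  have h2 : (M.image (finTreeFace N)).card ≤ M.card := Finset.card_image_le
  have h3 : M.biUnion treeFace ⊆
      ((M.image (finTreeFace N)).biUnion id).map Fin.valEmbedding := by
    refine Finset.biUnion_subset.2 fun m hm => ?_
    rw [← map_finTreeFace (hM' m hm).1 (hM' m hm).2, Finset.map_subset_map]
    exact Finset.subset_biUnion_of_mem id (Finset.mem_image_of_mem _ hm)
  have h4 := Finset.card_le_card h3
  rw [Finset.card_map] at h4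
  omega

theorem core_nonempty_of_mapFamily_finTree {n k : ℕ} {S : Finset (Finset (Fin n))}
    (φ : Fin (3 * 2 ^ k) ↪ Fin n) (h : mapFamily (finTree (3 * 2 ^ k)) φ ⊆ S) :
    (core^[k] (S : Set (Finset (Fin n)))).Nonempty := by
  have hN : 0 < 3 * 2 ^ k := by positivity
  -- The value beyond the range is arbitrary: `core_nonempty_of_tree` only looks at labels below
  -- 3·2^k.
  set g : ℕ → Fin n := fun x => if hx : x < 3 * 2 ^ k then φ ⟨x, hx⟩ else φ ⟨0, hN⟩
  have hg : ∀ x : Fin (3 * 2 ^ k), g x = φ x := fun x => by simp [g]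
  refine core_nonempty_of_tree g ?_ fun m h2 hm => ?_
  · intro x hx y hy hxy
    rw [hg ⟨x, hx⟩, hg ⟨y, hy⟩] at hxy
    simpa using φ.injective hxy
  · refine h (mem_mapFamily.2 ⟨finTreeFace _ m,
      Finset.mem_image_of_mem _ (Finset.mem_Ico.2 ⟨h2, hm⟩), ?_⟩)
    rw [← map_finTreeFace h2 hm, Finset.map_eq_image, Finset.map_eq_image, Finset.image_image]
    exact Finset.image_congr fun x _ => (hg x).symm

/-! ### Quantitative bounds at the two thresholds -/

theorem not_collapsible_iff {n k : ℕ} (Y : LMComplex n) :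
    ¬ CollapsibleInAtMost k Y.1 ↔
      (core^[k] (triangleFinset Y : Set (Finset (Fin n)))).Nonempty := by
  rw [collapsibleInAtMost_iff_core Y.dimLETwo, coe_triangleFinset, Set.nonempty_iff_ne_empty]

/-- This is the order of the expected number of configurations of j triangles on j+2 vertices when p
= x^(-1-a). The exponent is 0 in (a), where j = k+1, and nonnegative for all subfamilies of the tree
in (b). -/
theorem rpow_pow_mul_pow {x : ℝ} (hx : 0 < x) (a : ℝ) (j : ℕ) :
    (x ^ (-1 - a)) ^ j * x ^ (j + 2) = x ^ (2 - a * j) := by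
  rw [← Real.rpow_mul_natCast hx.le, ← Real.rpow_natCast x (j + 2), ← Real.rpow_add hx]
  congr 1
  push_cast
  ring

theorem eventProb_not_collapsible_le {n k : ℕ} (hn : k + 3 ≤ n) {p : ℝ} (h0 : 0 ≤ p)
    (h1 : p ≤ 1) :
    eventProb p {Y : LMComplex n | ¬ CollapsibleInAtMost k Y.1} ≤
      ∑ f ∈ Finset.Icc 1 k, ((f.choose 3).choose f : ℕ) * (p / n ^ (-1 - 2 / ((k : ℝ) + 1))) ^ f +
      (((k + 3).choose 3).choose (k + 1) : ℕ) *
        (p / n ^ (-1 - 2 / ((k : ℝ) + 1))) ^ (k + 1) := by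
  have hn0 : (0 : ℝ) < n := by exact_mod_cast (by omega : 0 < n)
  have hn1 : (1 : ℝ) ≤ n := by exact_mod_cast (by omega : 1 ≤ n)
  set a : ℝ := 2 / ((k : ℝ) + 1) with ha
  have ha0 : 0 < a := by positivity
  have hb : (0 : ℝ) < (n : ℝ) ^ (-1 - a) := Real.rpow_pos_of_pos hn0 _
  set r := p / (n : ℝ) ^ (-1 - a) with hr
  have hr0 : 0 ≤ r := div_nonneg h0 hb.le
  have hp : p = r * (n : ℝ) ^ (-1 - a) := by rw [hr, div_mul_cancel₀ _ hb.ne']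
  set D : ℕ → ℕ → Set (LMComplex n) := fun v f => {Y | ∃ F : Finset (Finset (Fin n)),
    F ⊆ triangleFinset Y ∧ F.card = f ∧ (F.biUnion id).card ≤ v}
  have hsub : {Y : LMComplex n | ¬ CollapsibleInAtMost k Y.1} ⊆
      {Y | ∃ f ∈ Finset.Icc 1 k, Y ∈ D f f} ∪ D (k + 3) (k + 1) := by
    intro Y hY
    have h3 : ∀ s ∈ (triangleFinset Y : Set (Finset (Fin n))), s.card = 3 := fun s hs =>
      (mem_triangleFinset.1 hs).2
    rcases exists_dense_of_core_nonempty h3 ((not_collapsible_iff Y).1 hY) with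
      ⟨f, hf, F, hF, h⟩ | ⟨F, hF, h⟩
    · exact Or.inl ⟨f, hf, F, Finset.coe_subset.1 hF, h⟩
    · exact Or.inr ⟨F, Finset.coe_subset.1 hF, h⟩
  refine (eventProb_mono h0 h1 hsub).trans ((eventProb_union_le h0 h1 _ _).trans
    (add_le_add ((eventProb_biUnion_le h0 h1 _ _).trans (Finset.sum_le_sum fun f hf => ?_)) ?_))
  · rw [Finset.mem_Icc] at hf
    refine (eventProb_exists_dense_le h0 h1 (by omega) f).trans
      (mul_le_mul_of_nonneg_left ?_ (Nat.cast_nonneg _))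
    rw [← mul_pow]
    refine pow_le_pow_left₀ (by positivity) ?_ _
    -- Sets with no more vertices than triangles only require np → 0, which is weaker than the
    -- threshold.
    have : (n : ℝ) * (n : ℝ) ^ (-1 - a) ≤ 1 := by
      rw [← Real.rpow_one_add' hn0.le (fun h => by linarith : (1 : ℝ) + (-1 - a) ≠ 0)]
      exact Real.rpow_le_one_of_one_le_of_nonpos hn1 (by linarith)
    calc (n : ℝ) * p = r * (n * (n : ℝ) ^ (-1 - a)) := by rw [hp]; ring
      _ ≤ r * 1 := mul_le_mul_of_nonneg_left this hr0
      _ = r := mul_one r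
  · refine (eventProb_exists_dense_le h0 h1 hn (k + 1)).trans_eq ?_
    congr 1
    have h := rpow_pow_mul_pow hn0 a (k + 1)
    have he : 2 - a * ((k + 1 : ℕ) : ℝ) = 0 := by
      rw [ha]; push_cast; field_simp; ring
    rw [he, Real.rpow_zero] at h
    calc (n : ℝ) ^ (k + 3) * p ^ (k + 1)
        = r ^ (k + 1) * (((n : ℝ) ^ (-1 - a)) ^ (k + 1) * n ^ (k + 1 + 2)) := by rw [hp]; ring
      _ = _ := by rw [h, mul_one]

theorem eventProb_collapsible_le {n k : ℕ} (hk : 1 ≤ k) (hn : 2 * (3 * 2 ^ k) ≤ n) {p : ℝ}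
    (h0 : 0 < p) (h1 : p ≤ 1) :
    eventProb p {Y : LMComplex n | CollapsibleInAtMost k Y.1} ≤
      ∑ A ∈ (finTree (3 * 2 ^ k)).powerset.erase ∅, (2 * (3 * 2 ^ k : ℕ) : ℝ) ^ (3 * 2 ^ k) *
        (n ^ (-1 - 1 / (3 * (2 : ℝ) ^ (k - 1) - 1)) / p) ^ A.card := by
  have hn' : 1 ≤ n := le_trans (by have := Nat.pow_pos (n := k) two_pos; omega) hn
  have hn0 : (0 : ℝ) < n := by exact_mod_cast hn'
  have hn1 : (1 : ℝ) ≤ n := by exact_mod_cast hn'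
  set a : ℝ := 1 / (3 * (2 : ℝ) ^ (k - 1) - 1) with ha
  have hsub : {Y : LMComplex n | CollapsibleInAtMost k Y.1} ⊆
      {Y | ∀ φ : Fin (3 * 2 ^ k) ↪ Fin n,
        ¬ mapFamily (finTree (3 * 2 ^ k)) φ ⊆ triangleFinset Y} := by
    intro Y hY φ hφ
    exact (not_collapsible_iff Y).2 (core_nonempty_of_mapFamily_finTree φ hφ) hY
  refine (eventProb_mono h0.le h1 hsub).trans
    ((eventProb_forall_not_mapFamily_le h0 h1 card_of_mem_finTree
      card_add_two_le_of_subset_finTree hn' (by simpa using hn)).trans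
      (Finset.sum_le_sum fun A hA => ?_))
  rw [Fintype.card_fin, div_eq_mul_inv]
  refine mul_le_mul_of_nonneg_left ?_ (by positivity)
  rw [div_pow, inv_le_comm₀ (by positivity) (by positivity), inv_div,
    div_le_iff₀ (by positivity)]
  have hcard : A.card ≤ 3 * 2 ^ k - 2 :=
    (Finset.card_le_card (Finset.mem_powerset.1 (Finset.mem_erase.1 hA).2)).trans
      (card_finTree_le _)
  -- Here a = 2/(3·2^k - 2), and the tree has at most 3·2^k - 2 triangles, so the full tree is the
  -- extreme case.
  have hexp : a * (A.card : ℝ) ≤ 2 := by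
    have hpow : (2 : ℝ) ^ k = 2 * 2 ^ (k - 1) := by
      rw [← pow_succ', Nat.sub_add_cancel hk]
    have h2 : (1 : ℝ) ≤ 2 ^ (k - 1) := one_le_pow₀ (by norm_num)
    have h3 : (A.card : ℝ) + 2 ≤ 3 * 2 ^ k := by
      have : A.card + 2 ≤ 3 * 2 ^ k := by
        have := Nat.pow_pos (n := k) two_pos
        omega
      exact_mod_cast this
    rw [ha, one_div_mul_eq_div, div_le_iff₀ (by linarith)]
    rw [hpow] at h3
    linarith
  have h := rpow_pow_mul_pow hn0 a A.card
  have h2 : (1 : ℝ) ≤ (n : ℝ) ^ (2 - a * A.card) := Real.one_le_rpow hn1 (by linarith)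
  rw [← h] at h2
  calc p ^ A.card = p ^ A.card * 1 := (mul_one _).symm
    _ ≤ p ^ A.card * (((n : ℝ) ^ (-1 - a)) ^ A.card * n ^ (A.card + 2)) :=
        mul_le_mul_of_nonneg_left h2 (by positivity)
    _ = _ := by ring

theorem asymptoticallyAlmostSurely_of_tendsto {p : ℕ → ℝ} (hp : ∀ᶠ n in atTop, 0 < p n ∧ p n < 1)
    {P : ∀ n : ℕ, PreAbstractSimplicialComplex (Fin n) → Prop} {u : ℕ → ℝ}
    (hu : Tendsto u atTop (𝓝 0))
    (h : ∀ᶠ n in atTop, eventProb (p n) {Y : LMComplex n | ¬ P n Y.1} ≤ u n) :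
    AsymptoticallyAlmostSurely p P := by
  have h0 : Tendsto (fun n => eventProb (p n) {Y : LMComplex n | ¬ P n Y.1}) atTop (𝓝 0) :=
    tendsto_of_tendsto_of_tendsto_of_le_of_le' tendsto_const_nhds hu
      (hp.mono fun n hn => eventProb_nonneg hn.1.le hn.2.le _) h
  have h1 := h0.const_sub 1
  rw [sub_zero] at h1
  refine h1.congr fun n => ?_
  rw [← eventProb_compl]
  congr 1
  ext Y
  simp

end RandomTwoComplex

open RandomTwoComplex in
theorem theorem1 (k : ℕ) (hk : 1 ≤ k) (p : ℕ → ℝ)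
    (hp : ∀ᶠ n in Filter.atTop, 0 < p n ∧ p n < 1) :
    (MuchLess p (fun n : ℕ => (n : ℝ) ^ (-1 - 2 / ((k : ℝ) + 1))) →
      AsymptoticallyAlmostSurely p (fun _ Y => CollapsibleInAtMost k Y)) ∧
    (MuchLess (fun n : ℕ => (n : ℝ) ^ (-1 - 1 / (3 * (2 : ℝ) ^ (k - 1) - 1))) p →
      AsymptoticallyAlmostSurely p (fun _ Y => ¬ CollapsibleInAtMost k Y)) := by
  constructor
  · rintro ⟨-, hr⟩
    have hu := (tendsto_finsetSum (Finset.Icc 1 k) fun f hf =>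
      (hr.pow f).const_mul (((f.choose 3).choose f : ℕ) : ℝ)).add
      ((hr.pow (k + 1)).const_mul ((((k + 3).choose 3).choose (k + 1) : ℕ) : ℝ))
    -- Every exponent is positive (f ≥ 1 and k + 1), so each term of the bound tends to 0; in (b)
    -- this is ensured by A ≠ ∅.
    rw [zero_pow (Nat.succ_ne_zero k), mul_zero, add_zero,
      Finset.sum_eq_zero fun f hf => by
        rw [zero_pow (by have := (Finset.mem_Icc.1 hf).1; omega), mul_zero]] at hu
    refine asymptoticallyAlmostSurely_of_tendsto hp hu ?_
    filter_upwards [hp, eventually_ge_atTop (k + 3)] with n hpn hn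
    exact eventProb_not_collapsible_le hn hpn.1.le hpn.2.le
  · rintro ⟨-, hr⟩
    have hu := tendsto_finsetSum ((finTree (3 * 2 ^ k)).powerset.erase ∅) fun A hA =>
      (hr.pow A.card).const_mul ((2 * (3 * 2 ^ k : ℕ) : ℝ) ^ (3 * 2 ^ k))
    rw [Finset.sum_eq_zero fun A hA => by
      rw [zero_pow (by simpa using (Finset.mem_erase.1 hA).1), mul_zero]] at hu
    refine asymptoticallyAlmostSurely_of_tendsto hp hu ?_
    filter_upwards [hp, eventually_ge_atTop (2 * (3 * 2 ^ k))] with n hpn hn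
    simp only [not_not]
    exact eventProb_collapsible_le hk hn hpn.1 hpn.2.le
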